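/- Let $F$ be a non-archimedean local field with valuation ring $\mathfrak{o}$ and maximal ideal $\mathfrak{p}$, and suppose $F$ is non-dyadic, i.e. $2 \in \mathfrak{o}^\times$. Let $V$ be a 2-dimensional $F$-vector space, let $H \cong \mathrm{End}(V)$ be a split quaternion algebra over $F$ with reduced trace $\mathrm{trd}$, reduced norm $\mathrm{nrd}$ and conjugation $\bar{x} = \mathrm{trd}(x) - x$, and let $\ddagger$ be an orthogonal involution on $H$: an $F$-linear map with $(xy)^\ddagger = y^\ddagger x^\ddagger$ and $x^{\ddagger\ddagger} = x$, whose spaces of symmetric and skew-symmetric elements have dimensions $3$ and $1$. Conventions. A $\ddagger$-order is an $\mathfrak{o}$-order $\mathcal{O} \subset H$ with $\mathcal{O}^\ddagger = \mathcal{O}$; it is maximal if it is not properly contained in another $\ddagger$-order. The discriminant of $\ddagger$ is the square class $\mathrm{disc}(\ddagger) = \mathrm{nrd}(h)(F^\times)^2$, where $h \in H^\times$ is any element with $h^\ddagger = -h$, and $\iota(\mathrm{disc}(\ddagger)) = \bigcup_{\lambda \in \mathrm{disc}(\ddagger) \cap \mathfrak{o}} \lambda\mathfrak{o}$. The discriminant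 $\mathrm{disc}(\mathcal{O})$ of an order is its reduced discriminant, the ideal generated by all $\mathrm{trd}((xy-yx)\bar z)$ with $x,y,z \in \mathcal{O}$; the discriminant $\mathrm{disc}(H)$ is $\mathfrak{p}$ if $H$ is a division algebra and $\mathfrak{o}$ otherwise (so here it is $\mathfrak{o}$). Isomorphisms of $\ddagger$-orders are induced by isomorphisms of $F$-algebras with involution. For a symmetric bilinear form $b$ on $V$ and a lattice $\Lambda \subset V$, put $\Lambda^\sharp = \{v \in V : b(v,\Lambda) \subset \mathfrak{o}\}$, $\mathfrak{n}\Lambda = \bigcup_{v \in \Lambda} b(v,v)\mathfrak{o}$ and $\mathrm{End}(\Lambda) = \{\sigma \in \mathrm{End}(V) : \sigma\Lambda \subset \Lambda\}$. For a nonzero fractional ideal $\mathfrak{a}$, $\Lambda$ is $\mathfrak{a}$-maximal if $\mathfrak{n}\Lambda \subset \mathfrak{a}$ and no properly larger lattice $\Lambda'$ satisfies $\mathfrak{n}\Lambda' \subset \mathfrak{a}$. Then: 1. There is a nonsingular symmetric bilinear form $b$ on $V$ with $b(v,\sigma w) = b(\sigma^\ddagger v, w)$ for all $v,w \in V$, $\sigma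 \in H$. For every such $b$ and every maximal $\ddagger$-order $\mathcal{O}$ of $H$ there are a nonzero ideal $\mathfrak{a} \subset \mathfrak{o}$ and an $\mathfrak{a}$-maximal lattice $\Lambda$ in $V$ such that $\mathcal{O} = \mathrm{End}(\Lambda) \cap \mathrm{End}(\Lambda^\sharp)$. 2. All maximal $\ddagger$-orders of $H$ are isomorphic: for any two of them, some automorphism of $(H,\ddagger)$ carries one onto the other. 3. Every maximal $\ddagger$-order $\mathcal{O}$ satisfies $\mathrm{disc}(\mathcal{O}) = \mathrm{disc}(H) \cap \iota(\mathrm{disc}(\ddagger))$. 4. There exists $\lambda \in \mathrm{disc}(\ddagger) \cap \mathfrak{o}$ generating $\iota(\mathrm{disc}(\ddagger))$. For every such $\lambda$, let $\ddagger_\lambda$ be the involution $$\begin{pmatrix} a & b \\ c & d \end{pmatrix}^{\ddagger_\lambda} = \begin{pmatrix} a & c/\lambda \\ b\lambda & d \end{pmatrix}$$ of $\mathrm{Mat}(2,F)$. Then for every maximal $\ddagger$-order $\mathcal{O}$ there is an isomorphism $(H,\ddagger) \to (\mathrm{Mat}(2,F),\ddagger_\lambda)$ of algebras with involution carrying $\mathcal{O}$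 onto $\mathrm{Mat}(2,\mathfrak{o}) \cap \mathrm{Mat}(2,\mathfrak{o})^{\ddagger_\lambda}$, which is $\mathrm{Mat}(2,\mathfrak{o})$ if $\iota(\mathrm{disc}(\ddagger)) = \mathfrak{o}$ and is the Eichler order $\left\{\begin{pmatrix} a & b \\ c & d \end{pmatrix} : a,b,d \in \mathfrak{o},\ c \in \mathfrak{p}\right\}$ of level $\mathfrak{p}$ if $\iota(\mathrm{disc}(\ddagger)) = \mathfrak{p}$; one of these two cases always occurs. -/

import Mathlib

open scoped ValuativeRel

noncomputable section

namespace DaggerOrder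

variable {F : Type*} [Field F] [ValuativeRel F]
variable {V : Type*} [AddCommGroup V] [Module F V]
variable {H : Type*} [Ring H] [Algebra F H]

/-! ### Involutions on a quaternion algebra -/

/-- An involution of the first kind on an `F`-algebra: an `F`-linear anti-multiplicative map of
order dividing two. -/
structure IsInvolution (τ : H →ₗ[F] H) : Prop where
  map_mul : ∀ x y, τ (x * y) = τ y * τ x
  map_map : ∀ x, τ (τ x) = x

/-- An involution on a quaternion algebra is orthogonal if its spaces of symmetric and of
skew-symmetric elements have dimension 3 and 1. -/
structure IsOrthogonalInvolution (τ : H →ₗ[F] H) : Prop extends IsInvolution τ where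
  finrank_symm : Module.finrank F (LinearMap.ker (τ - LinearMap.id)) = 3
  finrank_skew : Module.finrank F (LinearMap.ker (τ + LinearMap.id)) = 1

/-- `b` is a nonsingular symmetric bilinear form on `V` whose adjoint involution is `τ`, when `H`
is identified with `End(V)` through `e`. -/
structure IsAdjointForm (e : H ≃ₐ[F] Module.End F V) (τ : H →ₗ[F] H)
    (b : LinearMap.BilinForm F V) : Prop where
  symm : b.IsSymm
  nondegenerate : b.Nondegenerate
  adjoint : ∀ (σ : H) (v w : V), b v (e σ w) = b (e (τ σ) v) w

/-- The reduced trace of the split quaternion algebra `H`, computed through a splitting. -/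
def trd (e : H ≃ₐ[F] Module.End F V) (x : H) : F := LinearMap.trace F V (e x)

/-- The reduced norm of the split quaternion algebra `H`, computed through a splitting. -/
def nrd (e : H ≃ₐ[F] Module.End F V) (x : H) : F := LinearMap.det (e x)

/-- Quaternion conjugation (the standard involution) `x ↦ trd(x) - x`. -/
def conj (e : H ≃ₐ[F] Module.End F V) (x : H) : H := algebraMap F H (trd e x) - x

/-- The discriminant of an orthogonal involution, a class in `Fˣ / (Fˣ)²` seen as a subset of `F`:
the coset `nrd(h) · (Fˣ)²`, where `h` is an invertible skew-symmetric element. -/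
def invDisc (e : H ≃ₐ[F] Module.End F V) (τ : H →ₗ[F] H) : Set F :=
  {c | ∃ h : H, IsUnit h ∧ τ h = -h ∧ ∃ t : F, t ≠ 0 ∧ c = nrd e h * t ^ 2}

/-- The ideal attached to a square class `S`: the sum of the ideals `c 𝔬` with `c ∈ S` integral.
As `𝔬` is a valuation ring, this sum is also the union of these ideals. -/
def iota (S : Set F) : Ideal 𝒪[F] := ⨆ c : {c : 𝒪[F] // (c : F) ∈ S}, Ideal.span {(c : 𝒪[F])}

/-! ### Orders -/

/-- An `𝔬`-order of `H`: an `𝔬`-subalgebra that is a full `𝔬`-lattice. -/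
def IsOrder (O : Subalgebra 𝒪[F] H) : Prop :=
  Submodule.IsLattice F (Subalgebra.toSubmodule O)

/-- An order that is stable under the involution `τ`. -/
def IsInvOrder (τ : H →ₗ[F] H) (O : Subalgebra 𝒪[F] H) : Prop :=
  IsOrder O ∧ τ '' (O : Set H) = O

/-- A `τ`-stable order that is not properly contained in any other `τ`-stable order. -/
def IsMaximalInvOrder (τ : H →ₗ[F] H) (O : Subalgebra 𝒪[F] H) : Prop :=
  Maximal (IsInvOrder τ) O

/-- The (reduced) discriminant of an order `O`: the fractional ideal generated by all
`trd((x y - y x) z̄)` with `x, y, z ∈ O`.  Its square is the ideal generated by the determinants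
`det(trd(xᵢ xⱼ))` with `x₁, …, x₄ ∈ O`. -/
def orderDisc (e : H ≃ₐ[F] Module.End F V) (O : Subalgebra 𝒪[F] H) : Submodule 𝒪[F] F :=
  Submodule.span 𝒪[F]
    {c | ∃ x ∈ O, ∃ y ∈ O, ∃ z ∈ O, c = trd e ((x * y - y * x) * conj e z)}

variable (F H) in
open Classical in
/-- The discriminant of a quaternion algebra `H` over a nonarchimedean local field: the maximal
ideal if `H` is a division algebra, the unit ideal otherwise. -/
def algDisc : Ideal 𝒪[F] := if ∀ x : H, x ≠ 0 → IsUnit x then 𝓂[F] else ⊤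

/-! ### Lattices -/

/-- The endomorphism ring `End(Λ) = {σ ∈ End(V) : σ Λ ⊆ Λ}`. -/
def endOrder (L : Submodule 𝒪[F] V) : Subalgebra 𝒪[F] (Module.End F V) where
  carrier := {σ | ∀ v ∈ L, σ v ∈ L}
  mul_mem' := fun ha hb v hv => ha _ (hb v hv)
  add_mem' := fun ha hb v hv => L.add_mem (ha v hv) (hb v hv)
  algebraMap_mem' := fun r _ hv => L.smul_mem r hv

/-- The norm of a lattice: the sum of the ideals `q(v) 𝔬` with `v ∈ Λ`, where `q(v) = b(v, v)`.
As `𝔬` is a valuation ring, this sum is also the union of these ideals. -/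
def latticeNorm (b : LinearMap.BilinForm F V) (L : Submodule 𝒪[F] V) : Submodule 𝒪[F] F :=
  ⨆ v : L, Submodule.span 𝒪[F] {b (v : V) (v : V)}

/-- `L` is an `𝔞`-maximal lattice: its norm is contained in `𝔞`, and no properly larger lattice has
this property. -/
def IsMaximalLattice (b : LinearMap.BilinForm F V)
    (a : FractionalIdeal (nonZeroDivisors 𝒪[F]) F) (L : Submodule 𝒪[F] V) : Prop :=
  Submodule.IsLattice F L ∧ latticeNorm b L ≤ (a : Submodule 𝒪[F] F) ∧
    ∀ L' : Submodule 𝒪[F] V, Submodule.IsLattice F L' → L ≤ L' →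
      latticeNorm b L' ≤ (a : Submodule 𝒪[F] F) → L = L'

/-! ### The explicit models -/

/-- The involution `(a, b; c, d) ↦ (a, c / l; b l, d)` on `Mat(2, F)`. -/
def matInv (l : F) (M : Matrix (Fin 2) (Fin 2) F) : Matrix (Fin 2) (Fin 2) F :=
  !![M 0 0, M 1 0 / l; M 0 1 * l, M 1 1]

variable (F) in
/-- `Mat(2, 𝔬)`, inside `Mat(2, F)`. -/
def integralMatrices : Set (Matrix (Fin 2) (Fin 2) F) := {M | ∀ i j, M i j ∈ 𝒪[F]}

variable (F) in
/-- The standard Eichler order of level `𝔭`: the integral matrices whose lower left entry lies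
in `𝔭`. -/
def eichlerMatrices : Set (Matrix (Fin 2) (Fin 2) F) :=
  {M | (∀ i j, M i j ∈ 𝒪[F]) ∧ M 1 0 ∈ IsLocalization.coeSubmodule F 𝓂[F]}

end DaggerOrder

end

/-! A `τ`-stable order can be squeezed into an explicit one, and maximality then forces equality. An
order `O` stabilizes the lattice `Λ = O v₀` for any nonzero `v₀` (`exists_basis_stable`). As `2` is
a unit, `Λ` has an orthogonal basis with Gram matrix `γ · diag(m, 1)`, `m` integral
(`exists_isOrthoFrame_span_eq`). In this basis `τ` is `matInv m`, so stability puts `O` inside the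
matrices `(a, b; m c, d)` with `a, b, c, d` integral.

Write `m = l s²` with `l` a unit or a uniformizer. Dividing the first basis vector by `s` embeds
this order in the matrices `(a, b; l c, d)`, that is, in `levelOrder`
(`IsOrthoFrame.exists_rescale`). The latter is itself a `τ`-stable order, so a maximal `O` equals it
(`exists_isOrthoFrame_of_isMaximalInvOrder`).

All claims are read off from this normal form. The class of `l` is the discriminant of `τ`, and
since `l` is squarefree it generates `iota`; it also generates the discriminant of the order. The
lattice on the new basis is `γ𝔬`-maximal, again because `l` is squarefree. Two generators of `iota`
in the same square class differ by the square of a unit, so the model depends on `τ` only, and any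
two maximal orders are isomorphic through it. The form itself comes from Skolem–Noether
(`exists_adjoint_linearEquiv`), with symmetry supplied by the dimension of the skew elements. -/

noncomputable section

namespace DaggerOrder

/-! ### Valuations and squarefree parts -/

section Valuation

variable {F : Type*} [Field F] [ValuativeRel F]

lemma mem_integer_or_inv_mem_integer (t : F) :
    t ∈ 𝒪[F] ∨ t⁻¹ ∈ 𝒪[F] := by
  simp only [Valuation.mem_integer_iff]
  rcases le_total (ValuativeRel.valuation F t) 1 with h | h
  · exact Or.inl h
  · right
    rw [map_inv₀]
    exact inv_le_one_of_one_le₀ h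

lemma valuation_two (h2 : IsUnit (2 : 𝒪[F])) : ValuativeRel.valuation F 2 = 1 := by
  have h := (Valuation.integer.integers (ValuativeRel.valuation F)).isUnit_iff_valuation_eq_one.1 h2
  rwa [map_ofNat] at h

/-- If `l` is squarefree and `l t²` is integral, then `t` is integral. -/
lemma mem_integer_of_squarefree_mul_sq {l : 𝒪[F]} (hl : Squarefree l) {t : F}
    (h : (l : F) * t ^ 2 ∈ 𝒪[F]) : t ∈ 𝒪[F] := by
  rcases mem_integer_or_inv_mem_integer t with ht | ht
  · exact ht
  by_cases h0 : t = 0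
  · rw [h0]; exact zero_mem _
  -- `l = (t⁻¹)² · (l t²)`, so the square of `t⁻¹` divides the squarefree `l`.
  have hu : IsUnit (⟨t⁻¹, ht⟩ : 𝒪[F]) := by
    refine hl _ ⟨⟨_, h⟩, Subtype.ext ?_⟩
    simp only [MulMemClass.mk_mul_mk]
    field_simp
  obtain ⟨w, hw⟩ := hu.exists_right_inv
  have hw' : t⁻¹ * (w : F) = 1 := congrArg Subtype.val hw
  have : t = w := by field_simp at hw'; exact hw'.symm
  rw [this]; exact w.2

variable [TopologicalSpace F] [IsNonarchimedeanLocalField F]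

/-- The parity of the valuation of `m` decides between a unit and a uniformizer. Integrality of `s`
is what later makes the rescaled order larger rather than smaller. -/
lemma exists_eq_mul_sq {m : F} (hm : m ≠ 0) (hi : m ∈ 𝒪[F]) :
    ∃ (l : 𝒪[F]) (s : F), s ≠ 0 ∧ s ∈ 𝒪[F] ∧ (IsUnit l ∨ Irreducible l) ∧ m = l * s ^ 2 := by
  obtain ⟨p, hp⟩ := IsDiscreteValuationRing.exists_irreducible 𝒪[F]
  have hm' : (⟨m, hi⟩ : 𝒪[F]) ≠ 0 := fun h => hm (congrArg Subtype.val h)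
  obtain ⟨n, u, hu⟩ := IsDiscreteValuationRing.eq_unit_mul_pow_irreducible hm' hp
  have hmu : m = (u : 𝒪[F]) * (p : F) ^ n := by
    have := congrArg Subtype.val hu
    simpa using this
  have hp0 : (p : F) ≠ 0 := fun h => hp.ne_zero (Subtype.ext h)
  rcases Nat.even_or_odd' n with ⟨k, rfl | rfl⟩
  · refine ⟨u, (p : F) ^ k, pow_ne_zero _ hp0, pow_mem p.2 _, Or.inl u.isUnit, ?_⟩
    rw [hmu]; ring
  · refine ⟨u * p, (p : F) ^ k, pow_ne_zero _ hp0, pow_mem p.2 _, Or.inr ?_, ?_⟩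
    · exact (irreducible_units_mul u).2 hp
    · rw [hmu]; push_cast; ring

end Valuation

/-! ### Orthogonal bases and diagonalization of binary lattices -/

section Frames

variable {F : Type*} [Field F] {V : Type*} [AddCommGroup V] [Module F V]

/-- `f` is an orthogonal basis in which `b` has the Gram matrix `γ · diag(l, 1)`. -/
structure IsOrthoFrame (b : LinearMap.BilinForm F V) (f : Module.Basis (Fin 2) F V) (l γ : F) :
    Prop where
  apply_zero_zero : b (f 0) (f 0) = l * γ
  apply_one_one : b (f 1) (f 1) = γ
  apply_zero_one : b (f 0) (f 1) = 0
  apply_one_zero : b (f 1) (f 0) = 0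
  left_ne_zero : l ≠ 0
  right_ne_zero : γ ≠ 0

namespace IsOrthoFrame

variable {b : LinearMap.BilinForm F V} {f : Module.Basis (Fin 2) F V} {l γ : F}

lemma apply_left (h : IsOrthoFrame b f l γ) (v : V) : b v (f 0) = l * γ * f.repr v 0 := by
  conv_lhs => rw [← f.sum_repr v, Fin.sum_univ_two]
  simp [h.apply_zero_zero, h.apply_one_zero]
  ring

lemma apply_right (h : IsOrthoFrame b f l γ) (v : V) : b v (f 1) = γ * f.repr v 1 := by
  conv_lhs => rw [← f.sum_repr v, Fin.sum_univ_two]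
  simp [h.apply_zero_one, h.apply_one_one]
  ring

lemma apply_self (h : IsOrthoFrame b f l γ) (v : V) :
    b v v = γ * (l * f.repr v 0 ^ 2 + f.repr v 1 ^ 2) := by
  conv_lhs => rw [← f.sum_repr v, Fin.sum_univ_two]
  simp [h.apply_zero_zero, h.apply_one_zero, h.apply_zero_one, h.apply_one_one]
  ring

/-- Rescaling an orthogonal basis. -/
lemma unitsSMul (h : IsOrthoFrame b f l γ) (w : Fin 2 → Fˣ) :
    IsOrthoFrame b (f.unitsSMul w) (l * (w 0 / w 1) ^ 2) (γ * w 1 ^ 2) where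
  apply_zero_zero := by
    simp [Module.Basis.unitsSMul_apply, Units.smul_def, h.apply_zero_zero]
    field_simp
  apply_one_one := by
    simp [Module.Basis.unitsSMul_apply, Units.smul_def, h.apply_one_one]
    ring
  apply_zero_one := by simp [Module.Basis.unitsSMul_apply, Units.smul_def, h.apply_zero_one]
  apply_one_zero := by simp [Module.Basis.unitsSMul_apply, Units.smul_def, h.apply_one_zero]
  left_ne_zero := by simp [h.left_ne_zero]
  right_ne_zero := by simp [h.right_ne_zero]

end IsOrthoFrame

/-- The basis `(u₀ + c u₁, u₁)`. -/
lemma exists_basis_add_smul (u : Module.Basis (Fin 2) F V) (c : F) :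
    ∃ f : Module.Basis (Fin 2) F V, f 0 = u 0 + c • u 1 ∧ f 1 = u 1 := by
  have hli : LinearIndependent F ![u 0 + c • u 1, u 1] := by
    rw [LinearIndependent.pair_iff]
    intro s t hst
    have h0 := congrArg (fun v => u.repr v 0) hst
    have h1 := congrArg (fun v => u.repr v 1) hst
    simp at h0 h1
    refine ⟨h0, ?_⟩
    simpa [h0] using h1
  have : Module.Finite F V := Module.Finite.of_basis u
  refine ⟨basisOfLinearIndependentOfCardEqFinrank hli ?_, ?_, ?_⟩
  · rw [Module.finrank_eq_card_basis u]
  · simp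
  · simp

variable [ValuativeRel F]

lemma exists_basis_add_smul_span (u : Module.Basis (Fin 2) F V) {c : F} (hc : c ∈ 𝒪[F]) :
    ∃ f : Module.Basis (Fin 2) F V, f 0 = u 0 + c • u 1 ∧ f 1 = u 1 ∧
      Submodule.span 𝒪[F] (Set.range f) = Submodule.span 𝒪[F] (Set.range u) := by
  obtain ⟨f, h0, h1⟩ := exists_basis_add_smul u c
  refine ⟨f, h0, h1, le_antisymm ?_ ?_⟩
  · rw [Submodule.span_le]
    rintro _ ⟨i, rfl⟩
    fin_cases i
    · change f 0 ∈ Submodule.span 𝒪[F] (Set.range u)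
      rw [h0]
      exact add_mem (Submodule.subset_span ⟨0, rfl⟩)
        (Submodule.smul_mem _ (⟨c, hc⟩ : 𝒪[F]) (Submodule.subset_span ⟨1, rfl⟩))
    · exact h1 ▸ Submodule.subset_span ⟨1, rfl⟩
  · rw [Submodule.span_le]
    rintro _ ⟨i, rfl⟩
    fin_cases i
    · change u 0 ∈ Submodule.span 𝒪[F] (Set.range f)
      have : u 0 = f 0 - c • f 1 := by rw [h0, h1]; abel
      rw [this]
      exact sub_mem (Submodule.subset_span ⟨0, rfl⟩)
        (Submodule.smul_mem _ (⟨c, hc⟩ : 𝒪[F]) (Submodule.subset_span ⟨1, rfl⟩))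
    · exact h1 ▸ Submodule.subset_span ⟨1, rfl⟩

open ValuativeRel in
/-- If the value at the second basis vector dominates, the basis of a lattice can be
orthogonalized. -/
lemma exists_isOrthoFrame_of_dominant {b : LinearMap.BilinForm F V} (hs : b.IsSymm)
    (hn : b.Nondegenerate) (u : Module.Basis (Fin 2) F V)
    (h01 : valuation F (b (u 0) (u 1)) ≤ valuation F (b (u 1) (u 1)))
    (h00 : valuation F (b (u 0) (u 0)) ≤ valuation F (b (u 1) (u 1))) :
    ∃ (f : Module.Basis (Fin 2) F V) (m γ : F), IsOrthoFrame b f m γ ∧ m ∈ 𝒪[F] ∧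
      Submodule.span 𝒪[F] (Set.range f) = Submodule.span 𝒪[F] (Set.range u) := by
  have hsym : ∀ x y, b x y = b y x := fun x y => (hs.eq x y)
  set γ := b (u 1) (u 1) with hγ
  -- If `γ` vanished, domination would kill `b (u 0) (u 1)` too, and `u 1` would lie in the radical.
  have hγ0 : γ ≠ 0 := by
    intro h
    rw [h, Valuation.map_zero, le_zero_iff, map_eq_zero] at h01
    refine u.ne_zero 1 (hn.1 _ fun y => ?_)
    rw [← u.sum_repr y, Fin.sum_univ_two]
    simp [hsym (u 1) (u 0), h01, ← hγ, h]
  have hdiv : ∀ x, valuation F x ≤ valuation F γ → x / γ ∈ 𝒪[F] := by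
    intro x hx
    rw [Valuation.mem_integer_iff, map_div₀]
    exact div_le_one_of_le₀ hx zero_le
  -- Gram–Schmidt: domination makes the coefficient integral, so the lattice does not change.
  obtain ⟨f, hf0, hf1, hf⟩ :=
    exists_basis_add_smul_span u (c := -(b (u 0) (u 1) / γ)) (neg_mem (hdiv _ h01))
  have e01 : b (f 0) (f 1) = 0 := by
    rw [hf0, hf1]
    simp [← hγ]
    field_simp
    ring
  have e00 : b (f 0) (f 0) = (b (u 0) (u 0) / γ - (b (u 0) (u 1) / γ) ^ 2) * γ := by
    rw [hf0]
    simp [← hγ, hsym (u 1) (u 0)]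
    field_simp
    ring
  refine ⟨f, b (u 0) (u 0) / γ - (b (u 0) (u 1) / γ) ^ 2, γ,
    ⟨e00, by rw [hf1], e01, by rw [hsym, e01], ?_, hγ0⟩, ?_, hf⟩
  · intro h
    rw [h, zero_mul] at e00
    refine f.ne_zero 0 (hn.1 _ fun y => ?_)
    rw [← f.sum_repr y, Fin.sum_univ_two]
    simp [e00, e01]
  · exact sub_mem (hdiv _ h00) (pow_mem (hdiv _ h01) 2)

open ValuativeRel in
/-- Over a non-dyadic valuation ring, every binary lattice is diagonalizable. -/
lemma exists_isOrthoFrame_span_eq (h2 : IsUnit (2 : 𝒪[F])) {b : LinearMap.BilinForm F V}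
    (hs : b.IsSymm) (hn : b.Nondegenerate) (u : Module.Basis (Fin 2) F V) :
    ∃ (f : Module.Basis (Fin 2) F V) (m γ : F), IsOrthoFrame b f m γ ∧ m ∈ 𝒪[F] ∧
      Submodule.span 𝒪[F] (Set.range f) = Submodule.span 𝒪[F] (Set.range u) := by
  have hsym : ∀ x y, b x y = b y x := fun x y => (hs.eq x y)
  have key : ∀ u : Module.Basis (Fin 2) F V,
      valuation F (b (u 0) (u 1)) ≤ valuation F (b (u 0) (u 0)) →
      valuation F (b (u 1) (u 1)) ≤ valuation F (b (u 0) (u 0)) →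
      ∃ (f : Module.Basis (Fin 2) F V) (m γ : F), IsOrthoFrame b f m γ ∧ m ∈ 𝒪[F] ∧
        Submodule.span 𝒪[F] (Set.range f) = Submodule.span 𝒪[F] (Set.range u) := by
    intro u h01 h11
    have hr : Set.range (u.reindex (Equiv.swap 0 1)) = Set.range u := by simp
    rw [← hr]
    apply exists_isOrthoFrame_of_dominant hs hn
    · simpa [hsym (u 1) (u 0)] using h01
    · simpa using h11
  by_cases hA : valuation F (b (u 0) (u 1)) ≤ valuation F (b (u 1) (u 1))
  · rcases le_total (valuation F (b (u 0) (u 0))) (valuation F (b (u 1) (u 1))) with h | h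
    · exact exists_isOrthoFrame_of_dominant hs hn u hA h
    · exact key u (hA.trans h) h
  by_cases hB : valuation F (b (u 0) (u 1)) ≤ valuation F (b (u 0) (u 0))
  · rcases le_total (valuation F (b (u 0) (u 0))) (valuation F (b (u 1) (u 1))) with h | h
    · exact exists_isOrthoFrame_of_dominant hs hn u (hB.trans h) h
    · exact key u hB h
  -- The off-diagonal value strictly dominates. Replacing `u 0` by `u 0 + u 1` creates the diagonal
  -- value `2 b(u₀, u₁) + (smaller terms)`, which dominates because `2` is a unit.
  push Not at hA hB
  obtain ⟨g, hg0, hg1, hg⟩ := exists_basis_add_smul_span u (one_mem 𝒪[F])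
  rw [← hg]
  have v2 : valuation F (2 * b (u 0) (u 1)) = valuation F (b (u 0) (u 1)) := by
    rw [map_mul, valuation_two h2, one_mul]
  have e00 : b (g 0) (g 0) = 2 * b (u 0) (u 1) + (b (u 0) (u 0) + b (u 1) (u 1)) := by
    rw [hg0]
    simp [hsym (u 1) (u 0)]
    ring
  have v00 : valuation F (b (g 0) (g 0)) = valuation F (b (u 0) (u 1)) := by
    rw [e00, Valuation.map_add_eq_of_lt_left, v2]
    rw [v2]
    exact Valuation.map_add_lt _ hB hA
  have e01 : b (g 0) (g 1) = b (u 0) (u 1) + b (u 1) (u 1) := by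
    rw [hg0, hg1]; simp
  apply key
  · rw [v00, e01]
    exact Valuation.map_add_le _ le_rfl hA.le
  · rw [v00, hg1]
    exact hA.le

end Frames

/-! ### The matrix model of the involution and its standard order -/

section MatrixModel

variable {F : Type*} [Field F] {V : Type*} [AddCommGroup V] [Module F V]
variable {H : Type*} [Ring H] [Algebra F H]

/-- The identification of `H` with `Mat(2, F)` given by a basis of `V`. -/
def matRep (e : H ≃ₐ[F] Module.End F V) (f : Module.Basis (Fin 2) F V) :
    H ≃ₐ[F] Matrix (Fin 2) (Fin 2) F :=
  e.trans (LinearMap.toMatrixAlgEquiv f)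

lemma matRep_apply (e : H ≃ₐ[F] Module.End F V) (f : Module.Basis (Fin 2) F V) (x : H)
    (i j : Fin 2) : matRep e f x i j = f.repr (e x (f j)) i :=
  LinearMap.toMatrixAlgEquiv_apply f (e x) i j

lemma matRep_unitsSMul (e : H ≃ₐ[F] Module.End F V) (f : Module.Basis (Fin 2) F V)
    (w : Fin 2 → Fˣ) (x : H) (i j : Fin 2) :
    matRep e (f.unitsSMul w) x i j = (w i : F)⁻¹ * w j * matRep e f x i j := by
  simp only [matRep_apply, Module.Basis.repr_unitsSMul, Module.Basis.unitsSMul_apply,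
    Units.smul_def, map_smul, Finsupp.smul_apply, smul_eq_mul, Units.val_inv_eq_inv_val]
  ring

lemma trd_eq_trace (e : H ≃ₐ[F] Module.End F V) (f : Module.Basis (Fin 2) F V) (x : H) :
    trd e x = (matRep e f x).trace :=
  LinearMap.trace_eq_matrix_trace F f (e x)

lemma nrd_eq_det (e : H ≃ₐ[F] Module.End F V) (f : Module.Basis (Fin 2) F V) (x : H) :
    nrd e x = (matRep e f x).det :=
  (LinearMap.det_toMatrix f (e x)).symm

lemma apply_basis (e : H ≃ₐ[F] Module.End F V) (f : Module.Basis (Fin 2) F V) (x : H) (v : V)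
    (i : Fin 2) :
    f.repr (e x v) i = f.repr v 0 * matRep e f x i 0 + f.repr v 1 * matRep e f x i 1 := by
  conv_lhs => rw [← f.sum_repr v, Fin.sum_univ_two]
  simp [matRep_apply]

/-- In an orthogonal basis the adjoint involution takes the standard form. -/
lemma matRep_involution {e : H ≃ₐ[F] Module.End F V} {τ : H →ₗ[F] H}
    {b : LinearMap.BilinForm F V} (hb : IsAdjointForm e τ b) {f : Module.Basis (Fin 2) F V}
    {l γ : F} (hf : IsOrthoFrame b f l γ) (x : H) :
    matRep e f (τ x) = matInv l (matRep e f x) := by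
  have hl := hf.left_ne_zero
  have hγ := hf.right_ne_zero
  have key : ∀ i j, b (e x (f j)) (f i) = b (e (τ x) (f i)) (f j) := fun i j => by
    rw [← hb.adjoint]; exact hb.symm.eq _ _
  have h00 := key 0 0
  have h01 := key 0 1
  have h10 := key 1 0
  have h11 := key 1 1
  simp only [hf.apply_left, hf.apply_right, ← matRep_apply] at h00 h01 h10 h11
  ext i j
  fin_cases i <;> fin_cases j <;> simp [matInv]
  · exact (mul_left_cancel₀ (mul_ne_zero hl hγ) h00).symm
  · rw [eq_div_iff hl]
    apply mul_left_cancel₀ hγ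
    rw [h10]; ring
  · apply mul_left_cancel₀ hγ
    rw [← h01]; ring
  · exact (mul_left_cancel₀ hγ h11).symm

lemma matInv_matInv {l : F} (hl : l ≠ 0) (M : Matrix (Fin 2) (Fin 2) F) :
    matInv l (matInv l M) = M := by
  ext i j
  fin_cases i <;> fin_cases j <;> simp [matInv, hl]

/-- The skew elements for `matInv l` are the multiples of `(0, 1; -l, 0)`, whose determinant is `l`.
-/
lemma mem_invDisc_iff (e : H ≃ₐ[F] Module.End F V) (f : Module.Basis (Fin 2) F V)
    {τ : H →ₗ[F] H} {l : F} (hl : l ≠ 0) (h2 : (2 : F) ≠ 0)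
    (hf : ∀ x, matRep e f (τ x) = matInv l (matRep e f x)) (c : F) :
    c ∈ invDisc e τ ↔ ∃ t : F, t ≠ 0 ∧ c = l * t ^ 2 := by
  have neg_eq : ∀ a : F, a = -a → a = 0 := fun a h => by
    have : 2 * a = 0 := by linear_combination h
    simpa [h2] using this
  constructor
  · rintro ⟨h, hu, hs, t, ht, rfl⟩
    have hM := hf h
    rw [hs, map_neg] at hM
    set M := matRep e f h
    have e00 : M 0 0 = 0 := neg_eq _ (by simpa [matInv] using (congrFun (congrFun hM 0) 0).symm)
    have e11 : M 1 1 = 0 := neg_eq _ (by simpa [matInv] using (congrFun (congrFun hM 1) 1).symm)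
    have e10 : - M 1 0 = M 0 1 * l := by simpa [matInv] using congrFun (congrFun hM 1) 0
    have hdet : nrd e h = l * M 0 1 ^ 2 := by
      rw [nrd_eq_det e f, Matrix.det_fin_two]
      change M 0 0 * M 1 1 - M 0 1 * M 1 0 = _
      rw [e00, e11]
      linear_combination M 0 1 * e10
    have h0 : M 0 1 ≠ 0 := by
      intro h0
      have : IsUnit (nrd e h) := by
        rw [nrd_eq_det e f, ← Matrix.isUnit_iff_isUnit_det]
        exact hu.map (matRep e f)
      rw [hdet, h0] at this
      simp at this
    exact ⟨M 0 1 * t, mul_ne_zero h0 ht, by rw [hdet]; ring⟩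
  · rintro ⟨t, ht, rfl⟩
    set h := (matRep e f).symm !![0, 1; -l, 0] with hh
    have hM : matRep e f h = !![0, 1; -l, 0] := by simp [hh]
    have hdet : nrd e h = l := by rw [nrd_eq_det e f, hM]; simp [Matrix.det_fin_two]
    refine ⟨h, ?_, ?_, t, ht, by rw [hdet]⟩
    · have : IsUnit (matRep e f h) := by
        rw [Matrix.isUnit_iff_isUnit_det, ← nrd_eq_det, hdet]
        exact hl.isUnit
      simpa using this.map (matRep e f).symm
    · apply (matRep e f).injective
      rw [hf, map_neg, hM]
      ext i j
      fin_cases i <;> fin_cases j <;> simp [matInv, hl]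

variable [ValuativeRel F]

/-- The order of all elements whose matrix has the shape `(a, b; l c, d)` with integral `a`, `b`,
`c`, `d`. -/
def levelOrder (φ : H ≃ₐ[F] Matrix (Fin 2) (Fin 2) F) (l : 𝒪[F]) (hl : (l : F) ≠ 0) :
    Subalgebra 𝒪[F] H where
  carrier := {x | φ x 0 0 ∈ 𝒪[F] ∧ φ x 0 1 ∈ 𝒪[F] ∧ φ x 1 0 / l ∈ 𝒪[F] ∧ φ x 1 1 ∈ 𝒪[F]}
  mul_mem' := by
    rintro x y ⟨a, b, c, d⟩ ⟨a', b', c', d'⟩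
    simp only [Set.mem_ofPred_eq, map_mul, Matrix.mul_apply, Fin.sum_univ_two]
    refine ⟨add_mem (mul_mem a a') ?_, add_mem (mul_mem a b') (mul_mem b d'), ?_,
      add_mem ?_ (mul_mem d d')⟩
    · have := mul_mem (mul_mem b c') l.2
      rwa [mul_assoc, div_mul_cancel₀ _ hl] at this
    · have := add_mem (mul_mem c a') (mul_mem d c')
      rwa [div_mul_eq_mul_div, mul_div_assoc', ← add_div] at this
    · have := mul_mem (mul_mem c l.2) b'
      rwa [div_mul_cancel₀ _ hl] at this
  add_mem' := by
    rintro x y ⟨a, b, c, d⟩ ⟨a', b', c', d'⟩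
    simp only [Set.mem_ofPred_eq, map_add, Matrix.add_apply, add_div]
    exact ⟨add_mem a a', add_mem b b', add_mem c c', add_mem d d'⟩
  algebraMap_mem' := by
    intro r
    have : φ (algebraMap 𝒪[F] H r) = algebraMap F _ (r : F) := φ.commutes (r : F)
    simp [this, Matrix.algebraMap_matrix_apply]

variable (φ : H ≃ₐ[F] Matrix (Fin 2) (Fin 2) F) (l : 𝒪[F])

lemma mem_levelOrder (hl : (l : F) ≠ 0) {x : H} : x ∈ levelOrder φ l hl ↔
    φ x 0 0 ∈ 𝒪[F] ∧ φ x 0 1 ∈ 𝒪[F] ∧ φ x 1 0 / l ∈ 𝒪[F] ∧ φ x 1 1 ∈ 𝒪[F] := Iff.rfl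

/-- This identifies the order with `Mat(2, 𝔬) ∩ Mat(2, 𝔬)^τ`: the adjoint contributes exactly the
divisibility of the lower left entry by `l`. Stability under the involution is then visible. -/
lemma mem_levelOrder_iff (hl : (l : F) ≠ 0) {x : H} : x ∈ levelOrder φ l hl ↔
    φ x ∈ integralMatrices F ∧ matInv (l : F) (φ x) ∈ integralMatrices F := by
  rw [mem_levelOrder]
  simp only [integralMatrices, Set.mem_ofPred_eq, Fin.forall_fin_two, matInv, Matrix.of_apply,
    Matrix.cons_val_zero, Matrix.cons_val_one, Matrix.cons_val', Matrix.cons_val_fin_one]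
  constructor
  · rintro ⟨a, b, c, d⟩
    refine ⟨⟨⟨a, b⟩, ?_, d⟩, ⟨⟨a, c⟩, mul_mem b l.2, d⟩⟩
    have := mul_mem c l.2
    rwa [div_mul_cancel₀ _ hl] at this
  · rintro ⟨⟨⟨a, b⟩, -, d⟩, ⟨⟨-, c⟩, -, -⟩⟩
    exact ⟨a, b, c, d⟩

lemma levelOrder_generators_expansion (hl : (l : F) ≠ 0) (x : H) :
    x = φ x 0 0 • φ.symm !![1, 0; 0, 0] + φ x 0 1 • φ.symm !![0, 1; 0, 0]
      + (φ x 1 0 / l) • φ.symm !![0, 0; (l : F), 0] + φ x 1 1 • φ.symm !![0, 0; 0, 1] := by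
  apply φ.injective
  ext i j
  fin_cases i <;> fin_cases j <;> simp [hl]

/-- Generators of the order `levelOrder φ l`. -/
def levelOrderGenerators (φ : H ≃ₐ[F] Matrix (Fin 2) (Fin 2) F) (l : 𝒪[F]) : Set H :=
  {φ.symm !![1, 0; 0, 0], φ.symm !![0, 1; 0, 0], φ.symm !![0, 0; (l : F), 0],
    φ.symm !![0, 0; 0, 1]}

lemma levelOrderGenerators_subset (hl : (l : F) ≠ 0) :
    levelOrderGenerators φ l ⊆ (levelOrder φ l hl : Set H) := by
  rintro _ (rfl | rfl | rfl | rfl) <;>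
    simp [mem_levelOrder, hl]

lemma isOrder_levelOrder (hl : (l : F) ≠ 0) : IsOrder (levelOrder φ l hl) where
  fg := by
    have : Subalgebra.toSubmodule (levelOrder φ l hl) =
        Submodule.span 𝒪[F] (levelOrderGenerators φ l) := by
      apply le_antisymm
      · rintro x ⟨a, b, c, d⟩
        rw [levelOrder_generators_expansion φ l hl x]
        refine add_mem (add_mem (add_mem
          (Submodule.smul_mem _ (⟨_, a⟩ : 𝒪[F]) (Submodule.subset_span ?_))
          (Submodule.smul_mem _ (⟨_, b⟩ : 𝒪[F]) (Submodule.subset_span ?_)))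
          (Submodule.smul_mem _ (⟨_, c⟩ : 𝒪[F]) (Submodule.subset_span ?_)))
          (Submodule.smul_mem _ (⟨_, d⟩ : 𝒪[F]) (Submodule.subset_span ?_)) <;>
        simp [levelOrderGenerators]
      · exact Submodule.span_le.2 (levelOrderGenerators_subset φ l hl)
    rw [this]
    exact Submodule.fg_span (by simp [levelOrderGenerators])
  span_eq_top := by
    rw [eq_top_iff]
    rintro x -
    refine Submodule.span_mono (levelOrderGenerators_subset φ l hl) ?_
    rw [levelOrder_generators_expansion φ l hl x]
    refine add_mem (add_mem (add_mem
      (Submodule.smul_mem _ _ (Submodule.subset_span ?_))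
      (Submodule.smul_mem _ _ (Submodule.subset_span ?_)))
      (Submodule.smul_mem _ _ (Submodule.subset_span ?_)))
      (Submodule.smul_mem _ _ (Submodule.subset_span ?_)) <;>
    simp [levelOrderGenerators]

lemma isInvOrder_levelOrder (hl : (l : F) ≠ 0) {τ : H →ₗ[F] H} (hτ : ∀ x, τ (τ x) = x)
    (hφ : ∀ x, φ (τ x) = matInv (l : F) (φ x)) : IsInvOrder τ (levelOrder φ l hl) := by
  have hmem : ∀ x ∈ levelOrder φ l hl, τ x ∈ levelOrder φ l hl := by
    intro x hx
    rw [mem_levelOrder_iff] at hx ⊢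
    rw [hφ, matInv_matInv hl]
    exact hx.symm
  refine ⟨isOrder_levelOrder φ l hl, Set.Subset.antisymm ?_ fun x hx => ⟨τ x, hmem x hx, hτ x⟩⟩
  rintro _ ⟨x, hx, rfl⟩
  exact hmem x hx

end MatrixModel

/-! ### Stabilizers of lattices as integral matrices -/

section StableLattice

variable {F : Type*} [Field F] [ValuativeRel F] {V : Type*} [AddCommGroup V] [Module F V]
variable {H : Type*} [Ring H] [Algebra F H]

lemma mem_span_basis_iff (f : Module.Basis (Fin 2) F V) (v : V) :
    v ∈ Submodule.span 𝒪[F] (Set.range f) ↔ f.repr v 0 ∈ 𝒪[F] ∧ f.repr v 1 ∈ 𝒪[F] := by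
  rw [Module.Basis.mem_span_iff_repr_mem]
  have : ∀ c : F, c ∈ Set.range (algebraMap 𝒪[F] F) ↔ c ∈ 𝒪[F] := fun c =>
    ⟨by rintro ⟨y, rfl⟩; exact y.2, fun h => ⟨⟨c, h⟩, rfl⟩⟩
  simp only [this, Fin.forall_fin_two]

lemma stable_span_iff (e : H ≃ₐ[F] Module.End F V) (f : Module.Basis (Fin 2) F V) (x : H) :
    (∀ v ∈ Submodule.span 𝒪[F] (Set.range f), e x v ∈ Submodule.span 𝒪[F] (Set.range f)) ↔
      matRep e f x ∈ integralMatrices F := by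
  simp only [mem_span_basis_iff, integralMatrices, Set.mem_ofPred_eq]
  constructor
  · intro h i j
    have := h (f j) (by fin_cases j <;> simp)
    rw [← matRep_apply, ← matRep_apply] at this
    fin_cases i
    exacts [this.1, this.2]
  · rintro h v ⟨h0, h1⟩
    rw [apply_basis, apply_basis]
    exact ⟨add_mem (mul_mem h0 (h _ _)) (mul_mem h1 (h _ _)),
      add_mem (mul_mem h0 (h _ _)) (mul_mem h1 (h _ _))⟩

end StableLattice

/-! ### Normal form of a maximal order with involution -/

section NormalForm

variable {F : Type*} [Field F] [ValuativeRel F] [TopologicalSpace F] [IsNonarchimedeanLocalField F]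
variable {V : Type*} [AddCommGroup V] [Module F V]
variable {H : Type*} [Ring H] [Algebra F H]

/-- Every order of `End(V)` stabilizes a lattice. -/
lemma exists_basis_stable (hV : Module.finrank F V = 2) (e : H ≃ₐ[F] Module.End F V)
    {O : Subalgebra 𝒪[F] H} (hO : IsOrder O) :
    ∃ u : Module.Basis (Fin 2) F V, ∀ x ∈ O, ∀ v ∈ Submodule.span 𝒪[F] (Set.range u),
      e x v ∈ Submodule.span 𝒪[F] (Set.range u) := by
  have : Module.Finite F V := Module.finite_of_finrank_pos (by omega)
  have : Nontrivial V := Module.nontrivial_of_finrank_pos (R := F) (by omega)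
  obtain ⟨v₀, hv₀⟩ := exists_ne (0 : V)
  let g : H →ₗ[F] V := (LinearMap.applyₗ v₀).comp e.toLinearMap
  have hg : ∀ x, g x = e x v₀ := fun _ => rfl
  -- `L = O v₀` is stable since `O` is closed under products.
  let L : Submodule 𝒪[F] V := (Subalgebra.toSubmodule O).map (g.restrictScalars 𝒪[F])
  have hLmem : ∀ v, v ∈ L ↔ ∃ x ∈ O, e x v₀ = v := fun v => Iff.rfl
  have hL : Submodule.IsLattice F L := by
    refine ⟨hO.fg.map _, ?_⟩
    have h1 : (L : Set V) = g '' (O : Set H) := rfl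
    have h3 : Submodule.span F (O : Set H) = ⊤ := hO.span_eq_top
    rw [h1, Submodule.span_image, h3, Submodule.map_top, LinearMap.range_eq_top]
    intro v
    obtain ⟨φ, hφ⟩ := Module.Projective.exists_dual_ne_zero F hv₀
    -- A rank one endomorphism sending `v₀` to `v`; hence `H v₀ = V`, and `L` spans.
    refine ⟨e.symm (LinearMap.toSpanSingleton F V ((φ v₀)⁻¹ • v) ∘ₗ φ), ?_⟩
    rw [hg]
    simp [hφ]
  have hfree := Submodule.IsLattice.free F L
  have hfr : Module.finrank 𝒪[F] L = 2 := by
    rw [← hV]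
    exact congrArg Cardinal.toNat (Submodule.IsLattice.rank' F L)
  let B : Module.Basis (Fin 2) 𝒪[F] L := Module.finBasisOfFinrankEq 𝒪[F] L hfr
  let u := B.extendOfIsLattice F
  have hu : Submodule.span 𝒪[F] (Set.range u) = L := by
    have : Set.range u = L.subtype '' Set.range B := by
      rw [← Set.range_comp]
      congr 1
      ext k
      exact Module.Basis.extendOfIsLattice_apply F B k
    rw [this, Submodule.span_image, B.span_eq, Submodule.map_top, Submodule.range_subtype]
  refine ⟨u, fun x hx v hv => ?_⟩
  rw [hu] at hv ⊢
  obtain ⟨y, hy, rfl⟩ := (hLmem v).1 hv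
  exact (hLmem _).2 ⟨x * y, mul_mem hx hy, by simp⟩

/-- Rescaling an orthogonal basis so that the ratio of the two diagonal entries is a unit or a
uniformizer enlarges the associated order. -/
lemma IsOrthoFrame.exists_rescale {e : H ≃ₐ[F] Module.End F V}
    {b : LinearMap.BilinForm F V} {f : Module.Basis (Fin 2) F V} {m γ : F}
    (hf : IsOrthoFrame b f m γ) (hm : m ∈ 𝒪[F]) :
    ∃ (f' : Module.Basis (Fin 2) F V) (l : 𝒪[F]) (γ' : F) (hl : (l : F) ≠ 0),
      IsOrthoFrame b f' l γ' ∧ γ' ∈ 𝒪[F] ∧ (IsUnit l ∨ Irreducible l) ∧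
      ∀ x, matRep e f x ∈ integralMatrices F → matInv m (matRep e f x) ∈ integralMatrices F →
        x ∈ levelOrder (matRep e f') l hl := by
  obtain ⟨l, s, hs, hsi, hl, rfl⟩ := exists_eq_mul_sq hf.left_ne_zero hm
  have hl0 : (l : F) ≠ 0 := left_ne_zero_of_mul hf.left_ne_zero
  -- Scaling both basis vectors by `c` leaves the matrices unchanged and makes `γ` integral, so that
  -- the ideal `𝔞 = γ𝔬` will lie in `𝔬`.
  obtain ⟨c, hc, hcγ⟩ : ∃ c : F, c ≠ 0 ∧ γ * c ^ 2 ∈ 𝒪[F] := by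
    have hγ := hf.right_ne_zero
    rcases mem_integer_or_inv_mem_integer γ with h | h
    · exact ⟨1, one_ne_zero, by simpa using h⟩
    · refine ⟨γ⁻¹, inv_ne_zero hγ, ?_⟩
      have : γ * γ⁻¹ ^ 2 = γ⁻¹ := by field_simp
      rwa [this]
  have hfr := hf.unitsSMul ![Units.mk0 (c / s) (div_ne_zero hc hs), Units.mk0 c hc]
  have hle : (l : F) * s ^ 2 *
      (((![Units.mk0 (c / s) (div_ne_zero hc hs), Units.mk0 c hc] 0 : Fˣ) : F) /
        ((![Units.mk0 (c / s) (div_ne_zero hc hs), Units.mk0 c hc] 1 : Fˣ) : F)) ^ 2 = l := by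
    simp
    field_simp
  rw [hle] at hfr
  refine ⟨_, l, _, hl0, hfr, by simpa using hcγ, hl, fun x h1 h3 => ?_⟩
  rw [mem_levelOrder]
  simp only [matRep_unitsSMul]
  have h4 := h3 0 1
  simp only [matInv, Matrix.of_apply, Matrix.cons_val_zero, Matrix.cons_val_one,
    Matrix.cons_val', Matrix.cons_val_fin_one] at h4
  -- The upper right entry is multiplied by `s`. The lower left one is divided by `s`, and its
  -- quotient by `l` is `s` times the upper right entry of the adjoint.
  refine ⟨?_, ?_, ?_, ?_⟩
  · convert h1 0 0 using 1
    simp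
    field_simp
  · convert mul_mem hsi (h1 0 1) using 1
    simp
    field_simp
    simp
  · convert mul_mem hsi h4 using 1
    simp
    field_simp
  · convert h1 1 1 using 1
    simp
    field_simp

/-- The normal form of a maximal order with involution. -/
theorem exists_isOrthoFrame_of_isMaximalInvOrder (h2 : IsUnit (2 : 𝒪[F]))
    (hV : Module.finrank F V = 2) {e : H ≃ₐ[F] Module.End F V} {τ : H →ₗ[F] H}
    (hτ : ∀ x, τ (τ x) = x) {b : LinearMap.BilinForm F V} (hb : IsAdjointForm e τ b)
    {O : Subalgebra 𝒪[F] H} (hO : IsMaximalInvOrder τ O) :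
    ∃ (f : Module.Basis (Fin 2) F V) (l : 𝒪[F]) (γ : F) (hl : (l : F) ≠ 0),
      IsOrthoFrame b f l γ ∧ γ ∈ 𝒪[F] ∧ (IsUnit l ∨ Irreducible l) ∧
      O = levelOrder (matRep e f) l hl := by
  obtain ⟨u, hu⟩ := exists_basis_stable hV e hO.1.1
  obtain ⟨f, m, γ, hf, hm, hfu⟩ := exists_isOrthoFrame_span_eq h2 hb.symm hb.nondegenerate u
  obtain ⟨f', l, γ', hl, hf', hγ', hl', hsub⟩ := hf.exists_rescale (e := e) hm
  refine ⟨f', l, γ', hl, hf', hγ', hl', hO.eq_of_le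
    (isInvOrder_levelOrder _ _ _ hτ (matRep_involution hb hf')) fun x hx => ?_⟩
  have hint : ∀ y ∈ O, matRep e f y ∈ integralMatrices F := fun y hy => by
    rw [← stable_span_iff, hfu]
    exact hu y hy
  have hτx : τ x ∈ O := by
    have : τ x ∈ τ '' (O : Set H) := ⟨x, hx, rfl⟩
    rwa [hO.1.2] at this
  refine hsub x (hint x hx) ?_
  rw [← matRep_involution hb hf]
  exact hint _ hτx

end NormalForm

/-! ### Existence of the adjoint symmetric form -/

section AdjointForm

variable {F : Type*} [Field F] {V : Type*} [AddCommGroup V] [Module F V]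
variable {H : Type*} [Ring H] [Algebra F H]

/-- Every involution on `End(V)` is adjoint to a nonzero bilinear form. -/
lemma exists_adjoint_linearEquiv [Module.Finite F V] (e : H ≃ₐ[F] Module.End F V)
    {τ : H →ₗ[F] H} (hτ : IsInvolution τ) :
    ∃ T : V ≃ₗ[F] Module.Dual F V, ∀ x v w, T (e x v) w = T v (e (τ x) w) := by
  have hτ1 : τ 1 = 1 := by
    have h := hτ.map_mul (τ 1) 1
    rw [mul_one, hτ.map_map, mul_one] at h
    exact h.symm
  -- Transposing after `τ` composes two anti-automorphisms, which gives an algebra isomorphism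
  -- `End(V) ≃ End(V*)`. By Skolem–Noether it is conjugation by some `T : V ≃ V*`.
  let g : Module.End F V →ₗ[F] Module.End F (Module.Dual F V) :=
    Module.Dual.transpose ∘ₗ e.toLinearMap ∘ₗ τ ∘ₗ e.symm.toLinearMap
  have hg : ∀ σ φ v, g σ φ v = φ (e (τ (e.symm σ)) v) := fun _ _ _ => rfl
  let G : Module.End F V →ₐ[F] Module.End F (Module.Dual F V) := AlgHom.ofLinearMap g
    (by ext φ v; simp [hg, hτ1])
    (fun σ ρ => by ext φ v; simp [hg, hτ.map_mul])
  have hinj : Function.Injective G := by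
    refine (injective_iff_map_eq_zero G).2 fun σ hσ => ?_
    have h1 : e (τ (e.symm σ)) = 0 := by
      ext v
      refine (Module.forall_dual_apply_eq_zero_iff F _).1 fun φ => ?_
      exact (hg σ φ v).symm.trans (by
        change G σ φ v = 0
        rw [hσ]; rfl)
    have h3 : τ (e.symm σ) = 0 := by simpa using h1
    have h4 : e.symm σ = 0 := by rw [← hτ.map_map (e.symm σ), h3, map_zero]
    simpa using h4
  have hbij : Function.Bijective G := by
    refine ⟨hinj, (LinearMap.injective_iff_surjective_of_finrank_eq_finrank
      (V := Module.End F V)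
      (V₂ := Module.End F (Module.Dual F V)) (f := G.toLinearMap) ?_).1 hinj⟩
    change Module.finrank F (V →ₗ[F] V) =
      Module.finrank F (Module.Dual F V →ₗ[F] Module.Dual F V)
    rw [Module.finrank_linearMap, Module.finrank_linearMap, Subspace.dual_finrank_eq]
  obtain ⟨T, hT⟩ := AlgEquiv.eq_linearEquivConjAlgEquiv (AlgEquiv.ofBijective G hbij)
  refine ⟨T, fun x v w => ?_⟩
  have h := congrArg (fun A => A (e x) (T v) w) hT
  have h' : G (e x) (T v) w = T (e x v) w := by simpa using h
  rw [← h']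
  exact (hg _ _ _).trans (by simp)

/-- An orthogonal involution on `End(V)` is adjoint to a nonsingular symmetric bilinear form. -/
theorem exists_isAdjointForm (h2 : (2 : F) ≠ 0) (hV : Module.finrank F V = 2)
    (e : H ≃ₐ[F] Module.End F V)
    {τ : H →ₗ[F] H} (hτ : IsOrthogonalInvolution τ) :
    ∃ b : LinearMap.BilinForm F V, IsAdjointForm e τ b := by
  have : Module.Finite F V := Module.finite_of_finrank_pos (by omega)
  obtain ⟨T, hT⟩ := exists_adjoint_linearEquiv e hτ.toIsInvolution
  let S : LinearMap.BilinForm F V := T.toLinearMap + LinearMap.flip T.toLinearMap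
  have hS : ∀ v w, S v w = T v w + T w v := fun _ _ => rfl
  have hsymm : ∀ v w, S v w = S w v := fun v w => by rw [hS, hS, add_comm]
  have hadj : ∀ (x : H) (v w : V), S v (e x w) = S (e (τ x) v) w := fun x v w => by
    rw [hS, hS, hT, hT, hτ.map_map]
  -- If the symmetrization `S` vanished, `T` would be alternating, and every rank one map `v ↦ T(u,
  -- v) u` would be skew for `τ`. Two independent `u` give independent skew elements, against
  -- dimension one.
  have hS0 : ∃ v w, S v w ≠ 0 := by
    by_contra! h0
    have hskew : ∀ v w, T v w = - T w v := fun v w => eq_neg_of_add_eq_zero_left (h0 v w)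
    let E : V → H := fun u => e.symm (LinearMap.toSpanSingleton F V u ∘ₗ T u)
    have hE : ∀ u v, e (E u) v = T u v • u := fun u v => by simp [E]
    have hEskew : ∀ u, E u ∈ LinearMap.ker (τ + LinearMap.id) := fun u => by
      have : τ (E u) = - E u := by
        apply e.injective
        ext v
        rw [map_neg, LinearMap.neg_apply]
        refine (Module.forall_dual_apply_eq_zero_iff F _).1 (fun φ => ?_) |> sub_eq_zero.1
        obtain ⟨w, rfl⟩ := T.surjective φ
        rw [map_sub, map_neg, ← hT, hE, hE]
        simp only [map_smul, LinearMap.smul_apply, smul_eq_mul]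
        rw [hskew w u]; ring
      simp [this]
    let f := Module.finBasisOfFinrankEq F V hV
    have hself : ∀ v, T v v = 0 := fun v => by
      have : 2 * T v v = 0 := by linear_combination hskew v v
      simpa [h2] using this
    have hne : T (f 0) (f 1) ≠ 0 := fun h => by
      refine f.ne_zero 0 (T.injective ?_)
      rw [LinearEquiv.map_zero]
      exact f.ext fun i => by fin_cases i <;> simp [h, hself]
    obtain ⟨c, -, hc⟩ := finrank_eq_one_iff'.1 hτ.finrank_skew
    obtain ⟨a₀, ha₀⟩ := hc ⟨_, hEskew (f 0)⟩
    obtain ⟨a₁, ha₁⟩ := hc ⟨_, hEskew (f 1)⟩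
    have e0 : a₀ • (c : H) = E (f 0) := congrArg Subtype.val ha₀
    have e1 : a₁ • (c : H) = E (f 1) := congrArg Subtype.val ha₁
    have e2 : a₁ • E (f 0) = a₀ • E (f 1) := by rw [← e0, ← e1, smul_comm]
    have e3 : a₁ = 0 := by
      have := congrArg (fun z => e z (f 1)) e2
      simpa [hE, hself, hne, f.ne_zero] using this
    have e4 := hE (f 1) (f 0)
    rw [← e1, e3, zero_smul, map_zero, LinearMap.zero_apply, hskew] at e4
    exact smul_ne_zero (neg_ne_zero.2 hne) (f.ne_zero 1) e4.symm
  -- The radical is stable under `End(V)`, which moves any nonzero vector to any other; a nonzero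
  -- radical would force `S = 0`.
  have hsep : LinearMap.SeparatingLeft S := by
    intro v hv
    by_contra hv0
    obtain ⟨y, w, hyw⟩ := hS0
    obtain ⟨φ, hφ⟩ := Module.Projective.exists_dual_ne_zero F hv0
    apply hyw
    set x := e.symm (LinearMap.toSpanSingleton F V ((φ v)⁻¹ • y) ∘ₗ φ) with hx
    have hxv : e x v = y := by simp [hx, hφ]
    have h := hadj (τ x) v w
    rwa [hv, hτ.map_map, hxv, eq_comm] at h
  refine ⟨S, ⟨fun v w => hsymm v w⟩, ⟨hsep, fun v hv => hsep v fun w => ?_⟩, hadj⟩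
  rw [hsymm]; exact hv w

end AdjointForm

/-! ### Discriminants of the involution and of the order -/

section Discriminants

variable {F : Type*} [Field F] [ValuativeRel F]

/-- An integral `l t²` with `l` squarefree has `t` integral, so `l` divides every integral member of
its square class. -/
lemma iota_eq_span {S : Set F} {l : 𝒪[F]} (hl : Squarefree l)
    (hS : ∀ c : F, c ∈ S ↔ ∃ t : F, t ≠ 0 ∧ c = l * t ^ 2) : iota S = Ideal.span {l} := by
  apply le_antisymm
  · refine iSup_le ?_
    rintro ⟨c, hc⟩
    obtain ⟨t, -, ht⟩ := (hS _).1 hc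
    have hti : t ∈ 𝒪[F] := mem_integer_of_squarefree_mul_sq hl (ht ▸ c.2)
    rw [Ideal.span_singleton_le_span_singleton]
    exact ⟨⟨t, hti⟩ ^ 2, Subtype.ext (by simpa using ht)⟩
  · exact le_iSup (fun c : {c : 𝒪[F] // (c : F) ∈ S} => Ideal.span {(c : 𝒪[F])})
      ⟨l, (hS _).2 ⟨1, one_ne_zero, by simp⟩⟩

lemma mem_coeSubmodule_span_singleton {l : 𝒪[F]} (hl : (l : F) ≠ 0) (c : F) :
    c ∈ IsLocalization.coeSubmodule F (Ideal.span {l}) ↔ c / l ∈ 𝒪[F] := by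
  rw [IsLocalization.mem_coeSubmodule]
  constructor
  · rintro ⟨y, hy, rfl⟩
    obtain ⟨z, rfl⟩ := Ideal.mem_span_singleton'.1 hy
    have : (algebraMap 𝒪[F] F (z * l)) / l = z := by
      change ((z : F) * l) / l = z
      field_simp
    rw [this]; exact z.2
  · intro h
    refine ⟨⟨_, h⟩ * l, Ideal.mul_mem_left _ _ (Ideal.mem_span_singleton_self l), ?_⟩
    change c / l * (l : F) = c
    field_simp

variable {V : Type*} [AddCommGroup V] [Module F V] {H : Type*} [Ring H] [Algebra F H]

lemma algDisc_eq_top (φ : H ≃ₐ[F] Matrix (Fin 2) (Fin 2) F) : algDisc F H = ⊤ := by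
  refine if_neg fun h => ?_
  have h0 : φ.symm !![1, 0; 0, 0] ≠ 0 := fun h => by
    have h1 : (!![1, 0; 0, 0] : Matrix (Fin 2) (Fin 2) F) = 0 := by simpa using h
    simpa using congrFun (congrFun h1 0) 0
  have hu := (h _ h0).map φ
  rw [AlgEquiv.apply_symm_apply, Matrix.isUnit_iff_isUnit_det] at hu
  simp [Matrix.det_fin_two] at hu

/-- Each term of the expanded trace contains exactly one lower left entry, hence a factor `l`; the
triple `E₁₂`, `l E₂₁`, `E₂₂` attains `l`. -/
lemma orderDisc_levelOrder (e : H ≃ₐ[F] Module.End F V) (f : Module.Basis (Fin 2) F V)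
    {l : 𝒪[F]} (hl : (l : F) ≠ 0) :
    orderDisc e (levelOrder (matRep e f) l hl) =
      IsLocalization.coeSubmodule F (Ideal.span {l}) := by
  have htr : ∀ x y z : H, trd e ((x * y - y * x) * conj e z) =
      ((matRep e f x * matRep e f y - matRep e f y * matRep e f x) *
        (algebraMap F _ (matRep e f z).trace - matRep e f z)).trace := fun x y z => by
    rw [trd_eq_trace e f, conj, trd_eq_trace e f]
    simp only [map_mul, map_sub, AlgEquiv.commutes]
  apply le_antisymm
  · rw [orderDisc, Submodule.span_le]
    rintro _ ⟨x, ⟨a, b, c, d⟩, y, ⟨a', b', c', d'⟩, z, ⟨a'', b'', c'', d''⟩, rfl⟩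
    rw [SetLike.mem_coe, mem_coeSubmodule_span_singleton hl, htr]
    generalize matRep e f x = X at *
    generalize matRep e f y = Y at *
    generalize matRep e f z = Z at *
    have key : ((X * Y - Y * X) * (algebraMap F _ Z.trace - Z)).trace / l =
        (X 0 1 * (Y 1 0 / l) - Y 0 1 * (X 1 0 / l)) * (Z 1 1 - Z 0 0)
        - ((X 0 0 - X 1 1) * Y 0 1 - (Y 0 0 - Y 1 1) * X 0 1) * (Z 1 0 / l)
        - ((X 1 0 / l) * (Y 0 0 - Y 1 1) - (Y 1 0 / l) * (X 0 0 - X 1 1)) * Z 0 1 := by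
      simp [Matrix.trace_fin_two, Matrix.mul_apply, Fin.sum_univ_two,
        Matrix.algebraMap_matrix_apply]
      field_simp
      ring
    rw [key]
    exact sub_mem (sub_mem
      (mul_mem (sub_mem (mul_mem b c') (mul_mem b' c)) (sub_mem d'' a''))
      (mul_mem (sub_mem (mul_mem (sub_mem a d) b') (mul_mem (sub_mem a' d') b)) c''))
      (mul_mem (sub_mem (mul_mem c (sub_mem a' d')) (mul_mem c' (sub_mem a d))) b'')
  · have hmem : (l : F) ∈ orderDisc e (levelOrder (matRep e f) l hl) := by
      have hsub := levelOrderGenerators_subset (matRep e f) l hl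
      refine Submodule.subset_span ⟨_, hsub (Or.inr (Or.inl rfl)), _,
        hsub (Or.inr (Or.inr (Or.inl rfl))), _, hsub (Or.inr (Or.inr (Or.inr rfl))), ?_⟩
      rw [htr]
      simp [Matrix.trace_fin_two, Matrix.vecMul_eq_sum, Fin.sum_univ_two]
    intro c hc
    rw [mem_coeSubmodule_span_singleton hl] at hc
    have := Submodule.smul_mem _ (⟨_, hc⟩ : 𝒪[F]) hmem
    have hcl : (⟨_, hc⟩ : 𝒪[F]) • (l : F) = c := by
      change c / l * (l : F) = c
      field_simp
    rwa [hcl] at this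

end Discriminants

/-! ### Maximal lattices and endomorphism rings of dual lattices -/

section Lattices

variable {F : Type*} [Field F] [ValuativeRel F]
variable {V : Type*} [AddCommGroup V] [Module F V] {H : Type*} [Ring H] [Algebra F H]
variable {b : LinearMap.BilinForm F V}

lemma isLattice_span_basis (f : Module.Basis (Fin 2) F V) :
    Submodule.IsLattice F (Submodule.span 𝒪[F] (Set.range f)) where
  fg := Submodule.fg_span (Set.finite_range f)
  span_eq_top := by
    rw [eq_top_iff, ← f.span_eq]
    exact Submodule.span_mono Submodule.subset_span

lemma latticeNorm_le_iff (L : Submodule 𝒪[F] V) (N : Submodule 𝒪[F] F) :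
    latticeNorm b L ≤ N ↔ ∀ v ∈ L, b v v ∈ N := by
  simp [latticeNorm, iSup_le_iff, Submodule.span_le]

lemma mem_coe_spanSingleton {γ : F} (hγ : γ ≠ 0) (c : F) :
    c ∈ ((FractionalIdeal.spanSingleton (nonZeroDivisors 𝒪[F]) γ :
      FractionalIdeal (nonZeroDivisors 𝒪[F]) F) : Submodule 𝒪[F] F) ↔ c / γ ∈ 𝒪[F] := by
  rw [FractionalIdeal.mem_coe, FractionalIdeal.mem_spanSingleton]
  constructor
  · rintro ⟨z, rfl⟩
    have : (z • γ) / γ = (z : F) := by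
      change ((z : F) * γ) / γ = z
      field_simp
    rw [this]; exact z.2
  · intro h
    refine ⟨⟨_, h⟩, ?_⟩
    change c / γ * γ = c
    field_simp

/-- The lattice spanned by an orthogonal basis with squarefree ratio of the diagonal entries is
maximal. -/
lemma IsOrthoFrame.isMaximalLattice (h2 : IsUnit (2 : 𝒪[F])) (hs : b.IsSymm)
    {f : Module.Basis (Fin 2) F V} {l : 𝒪[F]} {γ : F} (hf : IsOrthoFrame b f l γ)
    (hl : Squarefree l) :
    IsMaximalLattice b (FractionalIdeal.spanSingleton (nonZeroDivisors 𝒪[F]) γ)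
      (Submodule.span 𝒪[F] (Set.range f)) := by
  have hγ := hf.right_ne_zero
  refine ⟨isLattice_span_basis f, ?_, fun L' _ hle hn => le_antisymm hle fun v hv => ?_⟩
  · rw [latticeNorm_le_iff]
    intro v hv
    rw [mem_span_basis_iff] at hv
    rw [mem_coe_spanSingleton hγ, hf.apply_self, mul_div_cancel_left₀ _ hγ]
    exact add_mem (mul_mem l.2 (pow_mem hv.1 2)) (pow_mem hv.2 2)
  · rw [latticeNorm_le_iff] at hn
    have hf1 : f 1 ∈ L' := hle (Submodule.subset_span ⟨1, rfl⟩)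
    have hn' : ∀ w ∈ L', b w w / γ ∈ 𝒪[F] := fun w hw =>
      (mem_coe_spanSingleton hγ _).1 (hn w hw)
    -- Polarizing against `f 1` bounds `2` times the second coordinate, and `2` is a unit. The first
    -- coordinate then follows from squarefreeness of `l`.
    have hv1 : f.repr v 1 ∈ 𝒪[F] := by
      have h := sub_mem (sub_mem (hn' _ (add_mem hv hf1)) (hn' _ hv)) (hn' _ hf1)
      have hsy : b (f 1) v = b v (f 1) := (hs.eq v (f 1)).symm
      have e : b (v + f 1) (v + f 1) / γ - b v v / γ - b (f 1) (f 1) / γ =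
          2 * f.repr v 1 := by
        simp only [map_add, LinearMap.add_apply, hsy, hf.apply_right v]
        field_simp
        ring
      rw [e] at h
      rwa [Valuation.mem_integer_iff, map_mul, valuation_two h2, one_mul] at h
    have hv0 : (l : F) * f.repr v 0 ^ 2 ∈ 𝒪[F] := by
      have h := hn' v hv
      rw [hf.apply_self, mul_div_cancel_left₀ _ hγ] at h
      simpa using sub_mem h (pow_mem hv1 2)
    exact (mem_span_basis_iff f v).2 ⟨mem_integer_of_squarefree_mul_sq hl hv0, hv1⟩

/-- An endomorphism preserves the dual lattice if and only if its adjoint preserves the lattice. -/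
lemma mem_endOrder_dual_iff {e : H ≃ₐ[F] Module.End F V} {τ : H →ₗ[F] H}
    (hτ : ∀ x, τ (τ x) = x) (hb : IsAdjointForm e τ b) (f : Module.Basis (Fin 2) F V) (x : H) :
    e x ∈ endOrder (b.dualSubmodule (Submodule.span 𝒪[F] (Set.range f))) ↔
      e (τ x) ∈ endOrder (Submodule.span 𝒪[F] (Set.range f)) := by
  have key : ∀ (L : Submodule 𝒪[F] V) (y : H), e y ∈ endOrder L →
      e (τ y) ∈ endOrder (b.dualSubmodule L) := by
    intro L y hy v hv w hw
    rw [← hb.adjoint]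
    exact hv _ (hy w hw)
  constructor
  · intro h
    have := key _ x h
    -- The converse is `key` applied to the dual lattice, since `Λ^♯♯ = Λ`.
    rwa [LinearMap.BilinForm.dualSubmodule_dualSubmodule_of_basis b hb.nondegenerate hb.symm] at this
  · intro h
    have := key _ _ h
    rwa [hτ] at this

lemma mem_levelOrder_iff_mem_endOrder {e : H ≃ₐ[F] Module.End F V} {τ : H →ₗ[F] H}
    (hτ : ∀ x, τ (τ x) = x) (hb : IsAdjointForm e τ b) {f : Module.Basis (Fin 2) F V}
    {l : 𝒪[F]} {γ : F} (hl : (l : F) ≠ 0) (hf : IsOrthoFrame b f l γ) (x : H) :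
    x ∈ levelOrder (matRep e f) l hl ↔
      e x ∈ endOrder (Submodule.span 𝒪[F] (Set.range f)) ⊓
        endOrder (b.dualSubmodule (Submodule.span 𝒪[F] (Set.range f))) := by
  rw [mem_levelOrder_iff, ← matRep_involution hb hf, ← stable_span_iff, ← stable_span_iff,
    Algebra.mem_inf, mem_endOrder_dual_iff hτ hb]
  rfl

end Lattices

/-! ### Images in the matrix algebra and change of parameter -/

section Models

variable {F : Type*} [Field F] [ValuativeRel F]
variable {V : Type*} [AddCommGroup V] [Module F V] {H : Type*} [Ring H] [Algebra F H]

lemma image_levelOrder (φ : H ≃ₐ[F] Matrix (Fin 2) (Fin 2) F) {l : 𝒪[F]} (hl : (l : F) ≠ 0) :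
    φ '' (levelOrder φ l hl : Set H) =
      integralMatrices F ∩ matInv (l : F) '' integralMatrices F := by
  ext M
  constructor
  · rintro ⟨x, hx, rfl⟩
    obtain ⟨h0, h1⟩ := (mem_levelOrder_iff φ l hl).1 hx
    exact ⟨h0, _, h1, matInv_matInv hl _⟩
  · rintro ⟨h0, N, hN, rfl⟩
    refine ⟨φ.symm (matInv (l : F) N), (mem_levelOrder_iff φ l hl).2 ?_, by simp⟩
    rw [AlgEquiv.apply_symm_apply, matInv_matInv hl]
    exact ⟨h0, hN⟩

lemma image_levelOrder_eq_setOf (φ : H ≃ₐ[F] Matrix (Fin 2) (Fin 2) F) {l : 𝒪[F]}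
    (hl : (l : F) ≠ 0) :
    φ '' (levelOrder φ l hl : Set H) =
      {M | (∀ i j, M i j ∈ 𝒪[F]) ∧ M 1 0 ∈ IsLocalization.coeSubmodule F (Ideal.span {l})} := by
  ext M
  simp only [Set.mem_ofPred_eq, mem_coeSubmodule_span_singleton hl, Fin.forall_fin_two]
  constructor
  · rintro ⟨x, hx, rfl⟩
    obtain ⟨a, b, c, d⟩ := hx
    refine ⟨⟨⟨a, b⟩, ?_, d⟩, c⟩
    have := mul_mem c l.2
    rwa [div_mul_cancel₀ _ hl] at this
  · rintro ⟨⟨⟨a, b⟩, -, d⟩, c⟩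
    refine ⟨φ.symm M, ?_, by simp⟩
    rw [SetLike.mem_coe, mem_levelOrder, AlgEquiv.apply_symm_apply]
    exact ⟨a, b, c, d⟩

/-- Changing the parameter of the model within its square class. -/
lemma IsOrthoFrame.exists_change_parameter {b : LinearMap.BilinForm F V}
    {e : H ≃ₐ[F] Module.End F V} {f : Module.Basis (Fin 2) F V} {l m : 𝒪[F]} {γ : F}
    (hf : IsOrthoFrame b f l γ) (hl : (l : F) ≠ 0) (hm : (m : F) ≠ 0)
    (hspan : Ideal.span {m} = Ideal.span {l}) {t : F} (ht : t ≠ 0) (hmt : (m : F) = l * t ^ 2) :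
    ∃ f' : Module.Basis (Fin 2) F V, IsOrthoFrame b f' m γ ∧
      levelOrder (matRep e f) l hl = levelOrder (matRep e f') m hm := by
  -- `l t²` and `l` are associates, so `t` is a unit; conjugation by `diag(t, 1)` then preserves
  -- integrality of all entries.
  have hu : ValuativeRel.valuation F t = 1 := by
    obtain ⟨u, hu⟩ := Ideal.span_singleton_eq_span_singleton.1 hspan
    have hu' : (m : F) * (u : 𝒪[F]) = l := congrArg Subtype.val hu
    have hvu := (Valuation.integer.integers
      (ValuativeRel.valuation F)).isUnit_iff_valuation_eq_one.1 u.isUnit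
    change ValuativeRel.valuation F ((u : 𝒪[F]) : F) = 1 at hvu
    have h1 : t ^ 2 * (u : 𝒪[F]) = 1 := by
      apply mul_left_cancel₀ hl
      rw [← mul_assoc, ← hmt, hu', mul_one]
    have h3 := congrArg (ValuativeRel.valuation F) h1
    rw [map_mul, hvu, mul_one, map_pow, map_one] at h3
    exact (pow_eq_one_iff_of_nonneg zero_le two_ne_zero).1 h3
  have hfr := hf.unitsSMul ![Units.mk0 t ht, 1]
  have hγ : γ * (((![Units.mk0 t ht, 1] 1 : Fˣ)) : F) ^ 2 = γ := by simp
  have hle : (l : F) * (((![Units.mk0 t ht, 1] 0 : Fˣ) : F) /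
        ((![Units.mk0 t ht, 1] 1 : Fˣ) : F)) ^ 2 = m := by
    simp [hmt]
  rw [hγ, hle] at hfr
  refine ⟨_, hfr, ?_⟩
  ext x
  rw [mem_levelOrder, mem_levelOrder]
  simp only [matRep_unitsSMul, Valuation.mem_integer_iff, map_mul, map_div₀, hmt, map_pow, map_inv₀]
  simp [hu]

end Models

end DaggerOrder

end

/-! ### Assembly of the theorem -/

open DaggerOrder in
theorem mainTheorem3
    {F : Type*} [Field F] [ValuativeRel F] [TopologicalSpace F] [IsNonarchimedeanLocalField F]
    (h2 : IsUnit (2 : 𝒪[F]))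
    {V : Type*} [AddCommGroup V] [Module F V] (hV : Module.finrank F V = 2)
    {H : Type*} [Ring H] [Algebra F H] (e : H ≃ₐ[F] Module.End F V)
    (τ : H →ₗ[F] H) (hτ : IsOrthogonalInvolution τ) :
    -- the involution is adjoint to a form, and for each such form every maximal order stable under
    -- the involution comes from an `𝔞`-maximal lattice
    (∃ b : LinearMap.BilinForm F V, IsAdjointForm e τ b) ∧
    (∀ b : LinearMap.BilinForm F V, IsAdjointForm e τ b →
      ∀ O : Subalgebra 𝒪[F] H, IsMaximalInvOrder τ O →
        ∃ a : FractionalIdeal (nonZeroDivisors 𝒪[F]) F, a ≠ 0 ∧ a ≤ 1 ∧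
          ∃ L : Submodule 𝒪[F] V, IsMaximalLattice b a L ∧
            ∀ x : H, x ∈ O ↔ e x ∈ endOrder L ⊓ endOrder (b.dualSubmodule L)) ∧
    -- all maximal orders stable under the involution are isomorphic
    (∀ O₁ O₂ : Subalgebra 𝒪[F] H, IsMaximalInvOrder τ O₁ → IsMaximalInvOrder τ O₂ →
      ∃ φ : H ≃ₐ[F] H, (∀ x, φ (τ x) = τ (φ x)) ∧ φ '' (O₁ : Set H) = O₂) ∧
    -- their discriminant
    (∀ O : Subalgebra 𝒪[F] H, IsMaximalInvOrder τ O →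
      orderDisc e O = IsLocalization.coeSubmodule F (algDisc F H ⊓ iota (invDisc e τ))) ∧
    -- the explicit description
    (∃ l : 𝒪[F], (l : F) ∈ invDisc e τ ∧ Ideal.span {l} = iota (invDisc e τ)) ∧
    (∀ l : 𝒪[F], (l : F) ∈ invDisc e τ → Ideal.span {l} = iota (invDisc e τ) →
      ∀ O : Subalgebra 𝒪[F] H, IsMaximalInvOrder τ O →
        ∃ φ : H ≃ₐ[F] Matrix (Fin 2) (Fin 2) F,
          (∀ x, φ (τ x) = matInv (l : F) (φ x)) ∧
          φ '' (O : Set H) = integralMatrices F ∩ matInv (l : F) '' integralMatrices F ∧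
          ((iota (invDisc e τ) = ⊤ ∧ φ '' (O : Set H) = integralMatrices F) ∨
            (iota (invDisc e τ) = 𝓂[F] ∧ φ '' (O : Set H) = eichlerMatrices F))) := by
  have h2F : (2 : F) ≠ 0 := fun h => by
    have := valuation_two h2
    rw [h, map_zero] at this
    exact zero_ne_one this
  obtain ⟨b₀, hb₀⟩ := exists_isAdjointForm h2F hV e hτ
  have hττ := hτ.map_map
  have hsq : ∀ l : 𝒪[F], IsUnit l ∨ Irreducible l → Squarefree l := fun l hl =>
    hl.elim IsUnit.squarefree Irreducible.squarefree
  have hdisc : ∀ {b : LinearMap.BilinForm F V}, IsAdjointForm e τ b →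
      ∀ {f : Module.Basis (Fin 2) F V} {l γ : F}, IsOrthoFrame b f l γ → ∀ c : F,
        c ∈ invDisc e τ ↔ ∃ t : F, t ≠ 0 ∧ c = l * t ^ 2 := fun hb f _ _ hf c =>
    mem_invDisc_iff e f hf.left_ne_zero h2F (matRep_involution hb hf) c
  -- No maximal order is needed here: any lattice, orthogonalized and rescaled, yields a squarefree
  -- representative of the discriminant.
  have hexists : ∃ l : 𝒪[F], (l : F) ∈ invDisc e τ ∧ Ideal.span {l} = iota (invDisc e τ) := by
    have : Module.Finite F V := Module.finite_of_finrank_pos (by omega)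
    obtain ⟨f, m, γ, hf, hm, -⟩ := exists_isOrthoFrame_span_eq h2 hb₀.symm hb₀.nondegenerate
      (Module.finBasisOfFinrankEq F V hV)
    obtain ⟨f', l, γ', -, hf', -, hl', -⟩ := hf.exists_rescale (e := e) hm
    exact ⟨l, (hdisc hb₀ hf' _).2 ⟨1, one_ne_zero, by simp⟩,
      (iota_eq_span (hsq l hl') (hdisc hb₀ hf')).symm⟩
  have hmodel : ∀ l : 𝒪[F], (l : F) ∈ invDisc e τ → Ideal.span {l} = iota (invDisc e τ) →
      ∀ O : Subalgebra 𝒪[F] H, IsMaximalInvOrder τ O →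
        ∃ φ : H ≃ₐ[F] Matrix (Fin 2) (Fin 2) F,
          (∀ x, φ (τ x) = matInv (l : F) (φ x)) ∧
          φ '' (O : Set H) = integralMatrices F ∩ matInv (l : F) '' integralMatrices F ∧
          ((iota (invDisc e τ) = ⊤ ∧ φ '' (O : Set H) = integralMatrices F) ∨
            (iota (invDisc e τ) = 𝓂[F] ∧ φ '' (O : Set H) = eichlerMatrices F)) := by
    intro m hm hspan O hO
    obtain ⟨f, l, γ, hl, hf, -, hl', rfl⟩ :=
      exists_isOrthoFrame_of_isMaximalInvOrder h2 hV hττ hb₀ hO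
    have hiota := iota_eq_span (hsq l hl') (hdisc hb₀ hf)
    obtain ⟨t, ht, hmt⟩ := (hdisc hb₀ hf _).1 hm
    have hm0 : (m : F) ≠ 0 := by rw [hmt]; exact mul_ne_zero hl (pow_ne_zero 2 ht)
    obtain ⟨f', hf', heq⟩ :=
      hf.exists_change_parameter (e := e) hl hm0 (hspan.trans hiota) ht hmt
    rw [heq]
    refine ⟨matRep e f', matRep_involution hb₀ hf', image_levelOrder _ hm0, ?_⟩
    rw [image_levelOrder_eq_setOf, hspan]
    rcases hl' with hl' | hl'
    · left
      have htop : iota (invDisc e τ) = ⊤ := by rw [hiota, Ideal.span_singleton_eq_top]; exact hl'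
      refine ⟨htop, ?_⟩
      ext M
      rw [htop]
      simp only [integralMatrices, Set.mem_ofPred_eq, and_iff_left_iff_imp]
      exact fun h => (IsLocalization.mem_coeSubmodule F _).2 ⟨⟨_, h 1 0⟩, trivial, rfl⟩
    · right
      have hmax : iota (invDisc e τ) = 𝓂[F] := by
        rw [hiota, (IsDiscreteValuationRing.irreducible_iff_uniformizer l).1 hl']
      exact ⟨hmax, by rw [hmax]; rfl⟩
  refine ⟨⟨b₀, hb₀⟩, ?_, ?_, ?_, hexists, hmodel⟩
  · intro b hb O hO
    obtain ⟨f, l, γ, hl, hf, hγ, hl', rfl⟩ :=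
      exists_isOrthoFrame_of_isMaximalInvOrder h2 hV hττ hb hO
    refine ⟨FractionalIdeal.spanSingleton _ γ, ?_, ?_, _,
      hf.isMaximalLattice h2 hb.symm (hsq l hl'), mem_levelOrder_iff_mem_endOrder hττ hb hl hf⟩
    · exact FractionalIdeal.spanSingleton_ne_zero_iff.2 hf.right_ne_zero
    · rw [FractionalIdeal.spanSingleton_le_iff_mem, FractionalIdeal.mem_one_iff]
      exact ⟨⟨γ, hγ⟩, rfl⟩
  · intro O₁ O₂ h₁ h₂
    obtain ⟨l, hl, hspan⟩ := hexists
    obtain ⟨φ, hφ, hφO, -⟩ := hmodel l hl hspan O₁ h₁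
    obtain ⟨ψ, hψ, hψO, -⟩ := hmodel l hl hspan O₂ h₂
    -- Both orders map onto the same model in `Mat(2, F)`, so `ψ⁻¹ ∘ φ` carries one to the other and
    -- commutes with `τ`.
    refine ⟨φ.trans ψ.symm, fun x => ψ.injective ?_, ?_⟩
    · simp [hφ, hψ]
    · have : (φ.trans ψ.symm) '' (O₁ : Set H) = ψ.symm '' (φ '' (O₁ : Set H)) := by
        rw [← Set.image_comp]; rfl
      rw [this, hφO, ← hψO, ← Set.image_comp]
      simp
  · intro O hO
    obtain ⟨f, l, γ, hl, hf, -, hl', rfl⟩ :=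
      exists_isOrthoFrame_of_isMaximalInvOrder h2 hV hττ hb₀ hO
    rw [orderDisc_levelOrder, algDisc_eq_top (matRep e f), top_inf_eq,
      iota_eq_span (hsq l hl') (hdisc hb₀ hf)]
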